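/- Let $R$ be a commutative Noetherian ring, $\mathfrak a$ an ideal of $R$ and $M$ a finitely generated $R$-module. Write $H^i_{\mathfrak a}(M)=\varinjlim_n \mathrm{Ext}^i_R(R/\mathfrak a^n,M)$ for the $i$-th local cohomology module of $M$ with respect to $\mathfrak a$, and $V(\mathfrak a)$ for the set of prime ideals of $R$ containing $\mathfrak a$. An element $x\in\mathfrak a$ is called an $\mathfrak a$-filter regular element of an $R$-module $N$ if $x\notin\mathfrak p$ for all $\mathfrak p\in\mathrm{Ass}_R N\setminus V(\mathfrak a)$; a sequence $x_1,\dots,x_t$ is called an $\mathfrak a$-filter regular sequence of $M$ if $x_k$ is an $\mathfrak a$-filter regular element of $M/(x_1,\dots,x_{k-1})M$ for every $k=1,\dots,t$. Let $t$ and $n_0$ be positive integers such that $\mathfrak a^{n_0}H^i_{\mathfrak a}(M)=0$ for all $i<t$. Then for every $\mathfrak a$-filter regular sequence $x_1,\dots,x_t$ of $M$ contained in $\mathfrak a^{2n_0}$ and all $j=1,\dots,t$, $$\bigcup_{i=0}^{j}\mathrm{Ass}_R\, H^i_{\mathfrak a}(M)=\mathrm{Ass}_R\bigl(M/(x_1,\dots,x_j)M\bigr)\cap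 V(\mathfrak a).$$ In particular, $H^t_{\mathfrak a}(M)$ has only finitely many associated primes. -/

import Mathlib

universe u

/-- The local cohomology module `H^i_𝔞(M)`: Mathlib's `localCohomology`, that is, the direct limit
over `n` of `Ext^i(R/𝔞^n, M)`, evaluated at the `R`-module `M`. -/
noncomputable abbrev LocalCohomologyModule {R : Type u} [CommRing R] (𝔞 : Ideal R) (i : ℕ)
    (M : Type u) [AddCommGroup M] [Module R M] : Type u :=
  (localCohomology 𝔞 i).obj (ModuleCat.of R M)

/-- `x ∈ 𝔞` is an `𝔞`-filter regular element of `M` if `x ∉ 𝔭` for every `𝔭 ∈ Ass M` which does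
not contain `𝔞`. -/
def IsFilterRegularElement {R : Type u} [CommRing R] (𝔞 : Ideal R)
    (M : Type u) [AddCommGroup M] [Module R M] (x : R) : Prop :=
  x ∈ 𝔞 ∧ ∀ 𝔭 ∈ associatedPrimes R M, ¬ 𝔞 ≤ 𝔭 → x ∉ 𝔭

/-- The submodule `(x₁, …, x_j)M` of `M` given by the first `j` terms of a sequence `x₁, …, x_t`
(which is `x 0, …, x (t - 1)` in zero-based indexing). -/
def initialSubmodule {R : Type u} [CommRing R] (M : Type u) [AddCommGroup M] [Module R M]
    {t : ℕ} (x : Fin t → R) (j : ℕ) : Submodule R M :=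
  Ideal.span (x '' {k : Fin t | (k : ℕ) < j}) • (⊤ : Submodule R M)

/-- `x₁, …, x_t` is an `𝔞`-filter regular sequence of `M` if each `x_k` is an `𝔞`-filter regular
element of `M/(x₁, …, x_{k-1})M`. -/
def IsFilterRegularSequence {R : Type u} [CommRing R] (𝔞 : Ideal R)
    (M : Type u) [AddCommGroup M] [Module R M] {t : ℕ} (x : Fin t → R) : Prop :=
  ∀ k : Fin t, IsFilterRegularElement 𝔞 (M ⧸ initialSubmodule M x k) (x k)

-- Put `I = 𝔞 ^ n₀` and let `x ∈ I * I` be filter regular on `M`. The kernel of `x` on `M` is killed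
-- by a power of `𝔞`, so it has no local cohomology in positive degrees and H^{i+1}(M) ≅
-- H^{i+1}(M/ker x). The sequence 0 → M/ker x → M → M/xM → 0 then gives, for i < t, an exact
-- sequence 0 → H^i(M) → H^i(M/xM) → H^{i+1}(M), since `x` kills H^i(M).
--
-- The second power of `I` provides a partial splitting. Write x = ∑ b_k a_k with all factors in
-- `I`; multiplication by `x` factors as M → M^ι → M, through the a_k and then the b_k. The first
-- map kills the `I`-torsion of H^{i+1}(M), the second kills H^i. Hence this torsion lifts linearly
-- to H^i(M/xM) (`exists_quotientδ_lift`, `exists_smul_lift`). An associated prime of H^{i+1}(M)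
-- contains `𝔞`, so it is already seen on this torsion, and Ass H^i(M/xM) = Ass H^i(M) ∪ Ass
-- H^{i+1}(M). For i + 1 < t the splitting also shows that `I` kills H^i(M/xM), so induction applies
-- to M/xM with t - 1. It ends at Ass H^0(N) = Ass N ∩ V(𝔞).

universe v w

/-! ### Comparison of derived-functor `Ext` with derived-category `Ext`, which carries the long
exact sequences. -/

section ExtComparison

open CategoryTheory Limits Opposite

namespace CategoryTheory.ProjectiveResolution

variable {C : Type u} [Category.{v} C] [Abelian C]

section
variable [HasExt.{w} C] {X Y : C} (P : ProjectiveResolution X)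

/-- A zero-cocycle represents the zero extension class only if it vanishes. -/
lemma extMk_zero_eq_zero_iff (f : P.complex.X 0 ⟶ Y) (hf : P.complex.d 1 0 ≫ f = 0) :
    P.extMk f 1 rfl hf = 0 ↔ f = 0 := by
  refine ⟨fun h => ?_, fun h => by subst h; exact P.extMk_zero 1 rfl⟩
  simp only [← P.extEquivCohomologyClass.apply_eq_iff_eq,
    extEquivCohomologyClass_extMk, extEquivCohomologyClass_zero,
    CochainComplex.HomComplex.CohomologyClass.mk_eq_zero_iff] at h
  rw [CochainComplex.HomComplex.Cocycle.toSingleMk_mem_coboundaries_iff _ _ _ _ _ 1 (by lia)] at h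
  obtain ⟨g, hg⟩ := h
  -- A coboundary here would come from cohomological degree 1, where the resolution is zero.
  have hz : IsZero (P.cochainComplex.X 1) := P.cochainComplex.isZero_of_isStrictlyLE 0 1 (by lia)
  rw [hz.eq_of_src g 0, comp_zero] at hg
  rw [← cancel_epi (P.cochainComplexXIso (-(0 : ℕ)) 0 rfl).hom]
  simpa using hg.symm

end

variable {R : Type v} [CommRing R] [Linear R C] [EnoughProjectives C]
  {X Y : C} (P : ProjectiveResolution X)

/-- The complex `Hom(P, Y)`, in the opposite category of modules. -/
noncomputable abbrev homComplexOp (R : Type v) [CommRing R] [Linear R C]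
    (P : ProjectiveResolution X) (Y : C) : ChainComplex (ModuleCat.{v} R)ᵒᵖ ℕ :=
  (((linearYoneda R C).obj Y).rightOp.mapHomologicalComplex _).obj P.complex

/-- The module of cocycles of `Hom(P, Y)` in degree `n`. -/
abbrev homCocycles (R : Type v) [CommRing R] [Linear R C] (P : ProjectiveResolution X)
    (Y : C) (n : ℕ) : Type v :=
  (unop ((P.homComplexOp R Y).opcycles n) : ModuleCat.{v} R)

/-- The cochain underlying a cocycle. -/
noncomputable def cocycleHom (n : ℕ) : P.homCocycles R Y n →ₗ[R] (P.complex.X n ⟶ Y) :=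
  ((P.homComplexOp R Y).pOpcycles n).unop.hom

/-- The left derived functors, computed by a projective resolution. -/
noncomputable def leftDerivedObjIso {D : Type*} [Category* D] [Abelian D] (F : C ⥤ D)
    [F.Additive] (n : ℕ) :
    (F.leftDerived n).obj X ≅ ((F.mapHomologicalComplex _).obj P.complex).homology n :=
  P.isoLeftDerivedObj F n

/-- The cohomology class of a cocycle. -/
noncomputable def cocycleClass (n : ℕ) :
    P.homCocycles R Y n →ₗ[R] ((_root_.Ext R C n).obj (op X)).obj Y :=
  ((P.leftDerivedObjIso ((linearYoneda R C).obj Y).rightOp n).hom ≫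
    (P.homComplexOp R Y).homologyι n).unop.hom

omit [EnoughProjectives C] in
lemma cocycleHom_injective (n : ℕ) :
    Function.Injective (P.cocycleHom (R := R) (Y := Y) n) := by
  exact (ModuleCat.mono_iff_injective _).1
    (inferInstanceAs (Mono ((P.homComplexOp R Y).pOpcycles n).unop))

lemma cocycleClass_surjective (n : ℕ) :
    Function.Surjective (P.cocycleClass (R := R) (Y := Y) n) := by
  have : Mono ((P.leftDerivedObjIso ((linearYoneda R C).obj Y).rightOp n).hom ≫
    (P.homComplexOp R Y).homologyι n) :=
    mono_comp _ _
  exact (ModuleCat.epi_iff_surjective _).1 (unop_epi_of_mono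
    ((P.leftDerivedObjIso ((linearYoneda R C).obj Y).rightOp n).hom ≫
    (P.homComplexOp R Y).homologyι n))

omit [EnoughProjectives C] in
lemma d_comp_cocycleHom (n : ℕ) (z : P.homCocycles R Y n) :
    P.complex.d (n + 1) n ≫ P.cocycleHom n z = 0 := by
  have h := congrArg (fun f => f.unop.hom z) ((P.homComplexOp R Y).d_pOpcycles (n + 1) n)
  exact h

omit [EnoughProjectives C] in
lemma exists_cocycle (n : ℕ) (f : P.complex.X n ⟶ Y) (hf : P.complex.d (n + 1) n ≫ f = 0) :
    ∃ z : P.homCocycles R Y n, P.cocycleHom n z = f := by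
  let K := P.homComplexOp R Y
  have hex := (ShortComplex.mk (K.d (n + 1) n) (K.pOpcycles n)
    (K.d_pOpcycles _ _)).exact_of_g_is_cokernel (K.opcyclesIsCokernel (n + 1) n (by simp))
  exact (ShortComplex.moduleCat_exact_iff _).1 hex.unop f hf

/-- Homology is the kernel of `fromOpcycles`; in the opposite category this makes coboundaries the
only cocycles with zero class. Keeping `next n` covers degree 0 too, where the differential is zero.
-/
lemma exists_fromOpcycles (n : ℕ) (z : P.homCocycles R Y n) (hz : P.cocycleClass n z = 0) :
    ∃ g : (unop ((P.homComplexOp R Y).X ((ComplexShape.down ℕ).next n)) : ModuleCat.{v} R),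
      ((P.homComplexOp R Y).d n ((ComplexShape.down ℕ).next n)).unop.hom g = P.cocycleHom n z := by
  let K := P.homComplexOp R Y
  have hex := (ShortComplex.mk (K.homologyι n) (K.fromOpcycles n _)
    (K.homologyι_comp_fromOpcycles _ _)).exact_of_f_is_kernel (K.homologyIsKernel n _ rfl)
  have hz' : (K.homologyι n).unop.hom z = 0 := by
    have hi := (ModuleCat.mono_iff_injective
      (P.leftDerivedObjIso ((linearYoneda R C).obj Y).rightOp n).hom.unop).1
      (inferInstanceAs (Mono (P.leftDerivedObjIso ((linearYoneda R C).obj Y).rightOp n).hom.unop))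
    apply hi
    exact hz.trans (map_zero _).symm
  obtain ⟨g, hg⟩ := (ShortComplex.moduleCat_exact_iff _).1 hex.unop z hz'
  refine ⟨g, ?_⟩
  rw [← hg]
  exact (congrArg (fun f => f.unop.hom g) (K.p_fromOpcycles n _)).symm

lemma cocycleClass_eq_zero (n : ℕ) (z : P.homCocycles R Y n)
    (g : (unop ((P.homComplexOp R Y).X ((ComplexShape.down ℕ).next n)) : ModuleCat.{v} R))
    (hg : ((P.homComplexOp R Y).d n ((ComplexShape.down ℕ).next n)).unop.hom g =
      P.cocycleHom n z) : P.cocycleClass n z = 0 := by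
  let K := P.homComplexOp R Y
  have h1 : z = (K.fromOpcycles n ((ComplexShape.down ℕ).next n)).unop.hom g := by
    apply P.cocycleHom_injective
    rw [← hg]
    exact (congrArg (fun f => f.unop.hom g) (K.p_fromOpcycles n _)).symm
  have h2 := congrArg (fun f => f.unop.hom g)
    (K.homologyι_comp_fromOpcycles n ((ComplexShape.down ℕ).next n))
  change (P.leftDerivedObjIso ((linearYoneda R C).obj Y).rightOp n).hom.unop.hom
    ((K.homologyι n).unop.hom z) = 0
  rw [h1]
  exact (congrArg _ h2).trans (map_zero _)

lemma cocycleClass_succ_eq_zero_iff (n : ℕ) (z : P.homCocycles R Y (n + 1)) :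
    P.cocycleClass (n + 1) z = 0 ↔
      ∃ g : P.complex.X n ⟶ Y, P.complex.d (n + 1) n ≫ g = P.cocycleHom (n + 1) z := by
  have hn : (ComplexShape.down ℕ).next (n + 1) = n := ChainComplex.next_nat_succ n
  constructor
  · intro h
    have := P.exists_fromOpcycles _ z h
    rw [hn] at this
    exact this
  · rintro ⟨g, hg⟩
    have := P.cocycleClass_eq_zero _ z
    rw [hn] at this
    exact this g hg

lemma cocycleClass_zero_eq_zero_iff (z : P.homCocycles R Y 0) :
    P.cocycleClass 0 z = 0 ↔ P.cocycleHom 0 z = 0 := by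
  have hd : (P.homComplexOp R Y).d 0 ((ComplexShape.down ℕ).next 0) = 0 :=
    (P.homComplexOp R Y).shape _ _ (by simp)
  constructor
  · intro h
    obtain ⟨g, hg⟩ := P.exists_fromOpcycles _ z h
    rw [← hg, hd]
    rfl
  · intro h
    refine P.cocycleClass_eq_zero _ z 0 ?_
    rw [h]
    exact map_zero _

section
variable [HasExt.{w} C]

/-- The extension class of a cocycle, in the derived category. -/
noncomputable def cocycleExt (n : ℕ) (z : P.homCocycles R Y n) : Abelian.Ext.{w} X Y n :=
  P.extMk (P.cocycleHom n z) (n + 1) rfl (P.d_comp_cocycleHom n z)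

omit [EnoughProjectives C] in
lemma cocycleExt_add (n : ℕ) (z z' : P.homCocycles R Y n) :
    P.cocycleExt n (z + z') = P.cocycleExt n z + P.cocycleExt n z' := by
  simp [cocycleExt, add_extMk]

omit [EnoughProjectives C] in
lemma cocycleExt_smul (n : ℕ) (r : R) (z : P.homCocycles R Y n) :
    P.cocycleExt n (r • z) = r • P.cocycleExt n z := by
  simp [cocycleExt, Abelian.Ext.smul_eq_comp_mk₀, extMk_comp_mk₀]

/-- `cocycleExt` as a linear map. -/
noncomputable def cocycleExtₗ (R : Type v) [CommRing R] [Linear R C] (P : ProjectiveResolution X)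
    (Y : C) (n : ℕ) : P.homCocycles R Y n →ₗ[R] Abelian.Ext.{w} X Y n where
  toFun := P.cocycleExt n
  map_add' := P.cocycleExt_add n
  map_smul' := P.cocycleExt_smul n

omit [EnoughProjectives C] in
lemma cocycleExtₗ_surjective (n : ℕ) : Function.Surjective (P.cocycleExtₗ R Y n) := by
  intro α
  obtain ⟨f, hf, rfl⟩ := P.extMk_surjective α (n + 1) rfl
  obtain ⟨z, rfl⟩ := P.exists_cocycle (R := R) n f hf
  exact ⟨z, rfl⟩

/-- Both kernels are the coboundaries, so both versions of `Ext` are the same quotient of the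
cocycles. -/
lemma ker_cocycleExtₗ (n : ℕ) :
    LinearMap.ker (P.cocycleExtₗ R Y n) = LinearMap.ker (P.cocycleClass (R := R) (Y := Y) n) := by
  ext z
  simp only [LinearMap.mem_ker]
  cases n with
  | zero =>
    rw [cocycleClass_zero_eq_zero_iff]
    exact P.extMk_zero_eq_zero_iff _ (P.d_comp_cocycleHom 0 z)
  | succ n =>
    rw [cocycleClass_succ_eq_zero_iff]
    exact P.extMk_eq_zero_iff _ _ rfl (P.d_comp_cocycleHom _ z) n rfl

/-- The two constructions of `Ext` agree. -/
noncomputable def extEquiv (R : Type v) [CommRing R] [Linear R C] (P : ProjectiveResolution X)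
    (Y : C) (n : ℕ) :
    Abelian.Ext.{w} X Y n ≃ₗ[R] ((_root_.Ext R C n).obj (op X)).obj Y :=
  ((P.cocycleExtₗ R Y n).quotKerEquivOfSurjective (P.cocycleExtₗ_surjective n)).symm ≪≫ₗ
    Submodule.quotEquivOfEq _ _ (P.ker_cocycleExtₗ n) ≪≫ₗ
    (P.cocycleClass n).quotKerEquivOfSurjective (P.cocycleClass_surjective n)

lemma extEquiv_cocycleExt (n : ℕ) (z : P.homCocycles R Y n) :
    P.extEquiv R Y n (P.cocycleExt n z) = P.cocycleClass n z := by
  have h : (P.cocycleExtₗ R Y n).quotKerEquivOfSurjective (P.cocycleExtₗ_surjective n)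
      (Submodule.Quotient.mk z) = P.cocycleExt n z := rfl
  rw [← h]
  simp [extEquiv]

lemma extEquiv_comp_mk₀ {Y' : C} (g : Y ⟶ Y') (n : ℕ) (α : Abelian.Ext.{w} X Y n) :
    P.extEquiv R Y' n (α.comp (Abelian.Ext.mk₀ g) (add_zero n)) =
      (((_root_.Ext R C n).obj (op X)).map g).hom (P.extEquiv R Y n α) := by
  obtain ⟨z, hz⟩ := P.cocycleExtₗ_surjective (R := R) n α
  obtain rfl : P.cocycleExt n z = α := hz
  let ν : ((linearYoneda R C).obj Y').rightOp ⟶ ((linearYoneda R C).obj Y).rightOp :=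
    NatTrans.rightOp ((linearYoneda R C).map g)
  -- The complexes live in the opposite category, so postcomposition with `g` runs from `Y'` to `Y`.
  let Φ : P.homComplexOp R Y' ⟶ P.homComplexOp R Y :=
    (NatTrans.mapHomologicalComplex ν _).app P.complex
  let z' : P.homCocycles R Y' n := (HomologicalComplex.opcyclesMap Φ n).unop.hom z
  have h1 : P.cocycleHom n z' = P.cocycleHom n z ≫ g :=
    congrArg (fun f => f.unop.hom z) (HomologicalComplex.p_opcyclesMap Φ n)
  have h2 : (P.cocycleExt n z).comp (Abelian.Ext.mk₀ g) (add_zero n) = P.cocycleExt n z' := by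
    simp only [cocycleExt, extMk_comp_mk₀, h1]
  rw [h2, extEquiv_cocycleExt, extEquiv_cocycleExt]
  have h3 : (NatTrans.leftDerived ν n).app X ≫ (P.leftDerivedObjIso _ n).hom =
      (P.leftDerivedObjIso _ n).hom ≫ HomologicalComplex.homologyMap Φ n := by
    rw [← Iso.eq_comp_inv, Category.assoc]
    exact leftDerived_app_eq ν P n
  have h4 : ((P.leftDerivedObjIso ((linearYoneda R C).obj Y').rightOp n).hom ≫
      (P.homComplexOp R Y').homologyι n) ≫ HomologicalComplex.opcyclesMap Φ n =
      (NatTrans.leftDerived ν n).app X ≫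
        ((P.leftDerivedObjIso ((linearYoneda R C).obj Y).rightOp n).hom ≫
          (P.homComplexOp R Y).homologyι n) := by
    rw [reassoc_of% h3, Category.assoc, HomologicalComplex.homologyι_naturality]
  exact congrArg (fun f => f.unop.hom z) h4

lemma extEquiv_mk₀_comp {X' : C} (P' : ProjectiveResolution X') (g : X' ⟶ X) (n : ℕ)
    (α : Abelian.Ext.{w} X Y n) :
    P'.extEquiv R Y n ((Abelian.Ext.mk₀ g).comp α (zero_add n)) =
      (((_root_.Ext R C n).map g.op).app Y).hom (P.extEquiv R Y n α) := by
  obtain ⟨z, hz⟩ := P.cocycleExtₗ_surjective (R := R) n α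
  obtain rfl : P.cocycleExt n z = α := hz
  let φ : P'.complex ⟶ P.complex := lift g P' P
  have hφ : φ.f 0 ≫ P.π.f 0 = P'.π.f 0 ≫ ((ChainComplex.single₀ C).map g).f 0 := by
    exact congrArg (fun f => f.f 0) (lift_commutes g P' P)
  let F := ((linearYoneda R C).obj Y).rightOp
  let Φ : P'.homComplexOp R Y ⟶ P.homComplexOp R Y := (F.mapHomologicalComplex _).map φ
  let z' : P'.homCocycles R Y n := (HomologicalComplex.opcyclesMap Φ n).unop.hom z
  have h1 : P'.cocycleHom n z' = φ.f n ≫ P.cocycleHom n z :=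
    congrArg (fun f => f.unop.hom z) (HomologicalComplex.p_opcyclesMap Φ n)
  have h2 : (Abelian.Ext.mk₀ g).comp (P.cocycleExt n z) (zero_add n) = P'.cocycleExt n z' := by
    simp only [cocycleExt, h1]
    exact P.mk₀_comp_extMk _ _ _ _ ⟨φ, hφ⟩
  rw [h2, extEquiv_cocycleExt, extEquiv_cocycleExt]
  have h3 : (F.leftDerived n).map g ≫ (P.leftDerivedObjIso F n).hom =
      (P'.leftDerivedObjIso F n).hom ≫ HomologicalComplex.homologyMap Φ n :=
    isoLeftDerivedObj_hom_naturality g P' P φ (by simpa using hφ) F n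
  have h4 : ((P'.leftDerivedObjIso F n).hom ≫
      (P'.homComplexOp R Y).homologyι n) ≫ HomologicalComplex.opcyclesMap Φ n =
      (F.leftDerived n).map g ≫ ((P.leftDerivedObjIso F n).hom ≫
          (P.homComplexOp R Y).homologyι n) := by
    rw [reassoc_of% h3, Category.assoc, HomologicalComplex.homologyι_naturality]
  exact congrArg (fun f => f.unop.hom z) h4

end

end CategoryTheory.ProjectiveResolution

end ExtComparison

/-! ### Local cohomology classes represented by extension classes -/

section LocalCohomologyElements

open CategoryTheory Limits Opposite

namespace localCohomology

variable {R : Type u} [CommRing R] (𝔞 : Ideal R)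

/-- The module `R / 𝔞ⁿ`. -/
noncomputable abbrev powQuot (n : ℕ) : ModuleCat.{u} R :=
  (ringModIdeals (idealPowersDiagram 𝔞)).obj (op n)

/-- The projection `R / 𝔞ⁿ ⟶ R / 𝔞ᵐ`. -/
noncomputable def powQuotMap {m n : ℕ} (h : m ≤ n) : powQuot 𝔞 n ⟶ powQuot 𝔞 m :=
  (ringModIdeals (idealPowersDiagram 𝔞)).map (homOfLE h).op

lemma powQuotMap_comp {l m n : ℕ} (h : l ≤ m) (h' : m ≤ n) :
    powQuotMap 𝔞 h' ≫ powQuotMap 𝔞 h = powQuotMap 𝔞 (h.trans h') := by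
  simp only [powQuotMap, ← Functor.map_comp]
  rfl

/-- The canonical map from a term of the direct system to its colimit. -/
noncomputable def coconeMap (i n : ℕ) (M : ModuleCat.{u} R) :
    ((_root_.Ext R (ModuleCat.{u} R) i).obj (op (powQuot 𝔞 n))).obj M →ₗ[R]
      (localCohomology 𝔞 i).obj M :=
  ((colimit.ι (diagram (idealPowersDiagram 𝔞) i) (op (op n))).app M).hom

/-- The canonical map from `Ext^i(R/𝔞ⁿ, M)` to local cohomology. -/
noncomputable def ofExt (i n : ℕ) (M : ModuleCat.{u} R) :
    Abelian.Ext.{u} (powQuot 𝔞 n) M i →ₗ[R] (localCohomology 𝔞 i).obj M :=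
  coconeMap 𝔞 i n M ∘ₗ ((projectiveResolution (powQuot 𝔞 n)).extEquiv R M i).toLinearMap

lemma map_ofExt {i n : ℕ} {M N : ModuleCat.{u} R} (g : M ⟶ N)
    (α : Abelian.Ext.{u} (powQuot 𝔞 n) M i) :
    ((localCohomology 𝔞 i).map g).hom (ofExt 𝔞 i n M α) =
      ofExt 𝔞 i n N (α.comp (Abelian.Ext.mk₀ g) (add_zero i)) := by
  have h := congrArg (fun f => f.hom ((projectiveResolution (powQuot 𝔞 n)).extEquiv R M i α))
    ((colimit.ι (diagram (idealPowersDiagram 𝔞) i) (op (op n))).naturality g)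
  refine Eq.trans h.symm ?_
  exact congrArg (coconeMap 𝔞 i n N) (ProjectiveResolution.extEquiv_comp_mk₀ _ g i α).symm

lemma ofExt_powQuotMap {i m n : ℕ} (h : m ≤ n) {M : ModuleCat.{u} R}
    (α : Abelian.Ext.{u} (powQuot 𝔞 m) M i) :
    ofExt 𝔞 i n M ((Abelian.Ext.mk₀ (powQuotMap 𝔞 h)).comp α (zero_add i)) =
      ofExt 𝔞 i m M α := by
  have hw := congrArg (fun f => (f.app M).hom
      ((projectiveResolution (powQuot 𝔞 m)).extEquiv R M i α))
    (colimit.w (diagram (idealPowersDiagram 𝔞) i) (homOfLE h).op.op)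
  refine Eq.trans ?_ hw
  exact congrArg (coconeMap 𝔞 i n M) (ProjectiveResolution.extEquiv_mk₀_comp
    (projectiveResolution (powQuot 𝔞 m)) (projectiveResolution (powQuot 𝔞 n)) _ i α)

lemma exists_ofExt {i : ℕ} {M : ModuleCat.{u} R} (y : (localCohomology 𝔞 i).obj M) :
    ∃ (n : ℕ) (α : Abelian.Ext.{u} (powQuot 𝔞 n) M i), ofExt 𝔞 i n M α = y := by
  -- The index category lives in universe 0, so preservation of filtered colimits has to be lowered
  -- to that size.
  have := preservesFilteredColimitsOfSize_shrink.{0, u, 0, u} (forget (ModuleCat.{u} R))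
  let hc := isColimitOfPreserves ((evaluation _ _).obj M)
    (colimit.isColimit (diagram (idealPowersDiagram 𝔞) i))
  obtain ⟨j, x, hx⟩ := Concrete.isColimit_exists_rep _ hc y
  obtain ⟨α, rfl⟩ := ((projectiveResolution (powQuot 𝔞 j.unop.unop)).extEquiv R M i).surjective x
  exact ⟨j.unop.unop, α, hx⟩

lemma exists_powQuotMap_comp_eq_zero {i n : ℕ} {M : ModuleCat.{u} R}
    (α : Abelian.Ext.{u} (powQuot 𝔞 n) M i) (hα : ofExt 𝔞 i n M α = 0) :
    ∃ (m : ℕ) (h : n ≤ m), (Abelian.Ext.mk₀ (powQuotMap 𝔞 h)).comp α (zero_add i) = 0 := by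
  have := preservesFilteredColimitsOfSize_shrink.{0, u, 0, u} (forget (ModuleCat.{u} R))
  let hc := isColimitOfPreserves ((evaluation _ _).obj M)
    (colimit.isColimit (diagram (idealPowersDiagram 𝔞) i))
  obtain ⟨k, f, g, hfg⟩ := Concrete.isColimit_exists_of_rep_eq _ hc
    ((projectiveResolution (powQuot 𝔞 n)).extEquiv R M i α)
    ((projectiveResolution (powQuot 𝔞 n)).extEquiv R M i 0) (by
      refine Eq.trans hα ?_
      rw [map_zero]
      exact (map_zero _).symm)
  refine ⟨k.unop.unop, leOfHom f.unop.unop, ?_⟩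
  apply ((projectiveResolution (powQuot 𝔞 k.unop.unop)).extEquiv R M i).injective
  rw [ProjectiveResolution.extEquiv_mk₀_comp (projectiveResolution (powQuot 𝔞 n)), map_zero]
  refine Eq.trans hfg ?_
  rw [map_zero]
  exact map_zero _

end localCohomology

end LocalCohomologyElements

/-! ### The long exact sequence of local cohomology -/

section LocalCohomologyExactSequence

open CategoryTheory Limits Opposite

namespace localCohomology

variable {R : Type u} [CommRing R] (𝔞 : Ideal R)

/-- Extension classes with the same image in local cohomology agree at some later stage. -/
lemma exists_powQuotMap_comp_eq {i m n : ℕ} {M : ModuleCat.{u} R}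
    (α : Abelian.Ext.{u} (powQuot 𝔞 m) M i) (β : Abelian.Ext.{u} (powQuot 𝔞 n) M i)
    (h : ofExt 𝔞 i m M α = ofExt 𝔞 i n M β) :
    ∃ (k : ℕ) (hm : m ≤ k) (hn : n ≤ k),
      (Abelian.Ext.mk₀ (powQuotMap 𝔞 hm)).comp α (zero_add i) =
        (Abelian.Ext.mk₀ (powQuotMap 𝔞 hn)).comp β (zero_add i) := by
  have hm := le_max_left m n
  have hn := le_max_right m n
  obtain ⟨k, hk, h0⟩ := exists_powQuotMap_comp_eq_zero 𝔞
    ((Abelian.Ext.mk₀ (powQuotMap 𝔞 hm)).comp α (zero_add i) -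
      (Abelian.Ext.mk₀ (powQuotMap 𝔞 hn)).comp β (zero_add i)) (by
        rw [map_sub, ofExt_powQuotMap, ofExt_powQuotMap, h, sub_self])
  refine ⟨k, hm.trans hk, hn.trans hk, ?_⟩
  rw [← sub_eq_zero, ← powQuotMap_comp 𝔞 hm hk, ← powQuotMap_comp 𝔞 hn hk,
    ← Abelian.Ext.mk₀_comp_mk₀, ← Abelian.Ext.mk₀_comp_mk₀]
  rw [Abelian.Ext.comp_assoc_of_second_deg_zero, Abelian.Ext.comp_assoc_of_second_deg_zero,
    sub_eq_add_neg, ← Abelian.Ext.comp_neg, ← Abelian.Ext.comp_add, ← sub_eq_add_neg, h0]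

lemma exists_ofExt₂ {i : ℕ} {M : ModuleCat.{u} R} (y z : (localCohomology 𝔞 i).obj M) :
    ∃ (n : ℕ) (α β : Abelian.Ext.{u} (powQuot 𝔞 n) M i),
      ofExt 𝔞 i n M α = y ∧ ofExt 𝔞 i n M β = z := by
  obtain ⟨m, α, rfl⟩ := exists_ofExt 𝔞 y
  obtain ⟨n, β, rfl⟩ := exists_ofExt 𝔞 z
  exact ⟨max m n, _, _, ofExt_powQuotMap 𝔞 (le_max_left m n) α,
    ofExt_powQuotMap 𝔞 (le_max_right m n) β⟩

instance (i : ℕ) : (localCohomology 𝔞 i).Additive where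
  map_add {M N f g} := by
    ext y
    obtain ⟨n, α, rfl⟩ := exists_ofExt 𝔞 y
    have h := map_ofExt 𝔞 (f + g) α
    rw [Abelian.Ext.mk₀_add, Abelian.Ext.comp_add, map_add, ← map_ofExt, ← map_ofExt] at h
    exact h

instance (i : ℕ) : (localCohomology 𝔞 i).Linear R where
  map_smul {M N} f r := by
    ext y
    obtain ⟨n, α, rfl⟩ := exists_ofExt 𝔞 y
    have h := map_ofExt 𝔞 (r • f) α
    rw [Abelian.Ext.mk₀_smul, Abelian.Ext.comp_smul, map_smul, ← map_ofExt] at h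
    exact h

section
variable {S : ShortComplex (ModuleCat.{u} R)} (hS : S.ShortExact)

-- This makes the connecting homomorphism independent of the chosen representative.
include hS in
lemma ofExt_comp_extClass_congr {i m n : ℕ}
    (α : Abelian.Ext.{u} (powQuot 𝔞 m) S.X₃ i) (β : Abelian.Ext.{u} (powQuot 𝔞 n) S.X₃ i)
    (h : ofExt 𝔞 i m S.X₃ α = ofExt 𝔞 i n S.X₃ β) :
    ofExt 𝔞 (i + 1) m S.X₁ (α.comp hS.extClass rfl) =
      ofExt 𝔞 (i + 1) n S.X₁ (β.comp hS.extClass rfl) := by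
  obtain ⟨k, hm, hn, h'⟩ := exists_powQuotMap_comp_eq 𝔞 α β h
  rw [← ofExt_powQuotMap 𝔞 hm, ← ofExt_powQuotMap 𝔞 hn,
    ← Abelian.Ext.comp_assoc _ _ _ (zero_add i) rfl (by lia), h',
    Abelian.Ext.comp_assoc _ _ _ (zero_add i) rfl (by lia)]

/-- The connecting homomorphism of local cohomology. -/
noncomputable def δ (i : ℕ) :
    (localCohomology 𝔞 i).obj S.X₃ →ₗ[R] (localCohomology 𝔞 (i + 1)).obj S.X₁ where
  toFun y := ofExt 𝔞 (i + 1) (exists_ofExt 𝔞 y).choose S.X₁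
    ((exists_ofExt 𝔞 y).choose_spec.choose.comp hS.extClass rfl)
  map_add' y z := by
    obtain ⟨n, α, β, hα, hβ⟩ := exists_ofExt₂ 𝔞 y z
    rw [ofExt_comp_extClass_congr 𝔞 hS _ (α + β)
        ((exists_ofExt 𝔞 (y + z)).choose_spec.choose_spec.trans (by rw [map_add, hα, hβ])),
      ofExt_comp_extClass_congr 𝔞 hS _ α ((exists_ofExt 𝔞 y).choose_spec.choose_spec.trans hα.symm),
      ofExt_comp_extClass_congr 𝔞 hS _ β ((exists_ofExt 𝔞 z).choose_spec.choose_spec.trans hβ.symm),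
      Abelian.Ext.add_comp, map_add]
  map_smul' r y := by
    obtain ⟨n, α, hα⟩ := exists_ofExt 𝔞 y
    rw [ofExt_comp_extClass_congr 𝔞 hS _ (r • α)
        ((exists_ofExt 𝔞 (r • y)).choose_spec.choose_spec.trans (by rw [map_smul, hα])),
      ofExt_comp_extClass_congr 𝔞 hS _ α ((exists_ofExt 𝔞 y).choose_spec.choose_spec.trans hα.symm),
      Abelian.Ext.smul_comp, map_smul, RingHom.id_apply]

lemma δ_ofExt (i n : ℕ) (α : Abelian.Ext.{u} (powQuot 𝔞 n) S.X₃ i) :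
    δ 𝔞 hS i (ofExt 𝔞 i n S.X₃ α) = ofExt 𝔞 (i + 1) n S.X₁ (α.comp hS.extClass rfl) :=
  ofExt_comp_extClass_congr 𝔞 hS _ α (exists_ofExt 𝔞 _).choose_spec.choose_spec

lemma δ_naturality {S' : ShortComplex (ModuleCat.{u} R)} (hS' : S'.ShortExact) (f : S ⟶ S')
    (i : ℕ) (y : (localCohomology 𝔞 i).obj S.X₃) :
    δ 𝔞 hS' i (((localCohomology 𝔞 i).map f.τ₃).hom y) =
      ((localCohomology 𝔞 (i + 1)).map f.τ₁).hom (δ 𝔞 hS i y) := by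
  obtain ⟨n, α, rfl⟩ := exists_ofExt 𝔞 y
  rw [map_ofExt, δ_ofExt, δ_ofExt, map_ofExt]
  rw [Abelian.Ext.comp_assoc _ _ _ (add_zero i) (zero_add 1) (by lia),
    ← ShortComplex.ShortExact.extClass_naturality hS hS' f,
    Abelian.Ext.comp_assoc _ _ _ rfl (add_zero 1) (by lia)]

-- Vanishing in the colimit already happens at a finite stage; the `Ext` sequence provides the lift
-- there. The other two exactness statements follow the same pattern.
include hS in
lemma exact_map_map (i : ℕ) :
    Function.Exact ((localCohomology 𝔞 i).map S.f).hom ((localCohomology 𝔞 i).map S.g).hom := by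
  intro y
  constructor
  · intro hy
    obtain ⟨n, α, rfl⟩ := exists_ofExt 𝔞 y
    rw [map_ofExt] at hy
    obtain ⟨m, h, hα⟩ := exists_powQuotMap_comp_eq_zero 𝔞 _ hy
    rw [← Abelian.Ext.comp_assoc_of_third_deg_zero] at hα
    obtain ⟨β, hβ⟩ := Abelian.Ext.covariant_sequence_exact₂ _ hS _ hα
    exact ⟨ofExt 𝔞 i m _ β, by rw [map_ofExt, hβ, ofExt_powQuotMap]⟩
  · rintro ⟨x, rfl⟩
    have := congrArg (fun f => f.hom x) ((localCohomology 𝔞 i).map_comp S.f S.g)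
    rw [S.zero, Functor.map_zero] at this
    exact this.symm

lemma exact_map_δ (i : ℕ) :
    Function.Exact ((localCohomology 𝔞 i).map S.g).hom (δ 𝔞 hS i) := by
  intro y
  constructor
  · intro hy
    obtain ⟨n, α, rfl⟩ := exists_ofExt 𝔞 y
    rw [δ_ofExt] at hy
    obtain ⟨m, h, hα⟩ := exists_powQuotMap_comp_eq_zero 𝔞 _ hy
    rw [← Abelian.Ext.comp_assoc _ _ _ (zero_add i) rfl (by lia)] at hα
    obtain ⟨β, hβ⟩ := Abelian.Ext.covariant_sequence_exact₃ _ hS _ _ hα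
    exact ⟨ofExt 𝔞 i m _ β, by rw [map_ofExt, hβ, ofExt_powQuotMap]⟩
  · rintro ⟨x, rfl⟩
    obtain ⟨n, α, rfl⟩ := exists_ofExt 𝔞 x
    rw [map_ofExt, δ_ofExt, Abelian.Ext.comp_assoc _ _ _ (add_zero i) (zero_add 1) (by lia),
      ShortComplex.ShortExact.comp_extClass, Abelian.Ext.comp_zero, map_zero]

lemma exact_δ_map (i : ℕ) :
    Function.Exact (δ 𝔞 hS i) ((localCohomology 𝔞 (i + 1)).map S.f).hom := by
  intro y
  constructor
  · intro hy
    obtain ⟨n, α, rfl⟩ := exists_ofExt 𝔞 y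
    rw [map_ofExt] at hy
    obtain ⟨m, h, hα⟩ := exists_powQuotMap_comp_eq_zero 𝔞 _ hy
    rw [← Abelian.Ext.comp_assoc_of_third_deg_zero] at hα
    obtain ⟨β, hβ⟩ := Abelian.Ext.covariant_sequence_exact₁ _ hS _ hα rfl
    exact ⟨ofExt 𝔞 i m _ β, by rw [δ_ofExt, hβ, ofExt_powQuotMap]⟩
  · rintro ⟨x, rfl⟩
    obtain ⟨n, α, rfl⟩ := exists_ofExt 𝔞 x
    rw [δ_ofExt, map_ofExt, Abelian.Ext.comp_assoc _ _ _ rfl (add_zero 1) (by lia),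
      ShortComplex.ShortExact.extClass_comp, Abelian.Ext.comp_zero, map_zero]

end

end localCohomology

end LocalCohomologyExactSequence

/-! ### Torsion, degree zero, and vanishing for modules killed by a power of `𝔞` -/

section LocalCohomologyTorsion

open CategoryTheory Limits Opposite

namespace localCohomology

variable {R : Type u} [CommRing R] (𝔞 : Ideal R)

lemma smul_id_powQuot {n : ℕ} {r : R} (hr : r ∈ 𝔞 ^ n) : r • 𝟙 (powQuot 𝔞 n) = 0 := by
  ext y
  obtain ⟨s, rfl⟩ := Ideal.Quotient.mk_surjective y
  change r • Ideal.Quotient.mk (𝔞 ^ n) s = 0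
  rw [← Ideal.Quotient.mk_eq_mk, ← Submodule.Quotient.mk_smul, Ideal.Quotient.mk_eq_mk,
    Ideal.Quotient.eq_zero_iff_mem, smul_eq_mul]
  exact Ideal.mul_mem_right _ _ hr

/-- Every element of local cohomology is killed by a power of the ideal. -/
lemma exists_pow_smul_eq_zero {i : ℕ} {M : ModuleCat.{u} R} (y : (localCohomology 𝔞 i).obj M) :
    ∃ n : ℕ, ∀ r ∈ 𝔞 ^ n, r • y = 0 := by
  obtain ⟨n, α, rfl⟩ := exists_ofExt 𝔞 y
  refine ⟨n, fun r hr => ?_⟩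
  rw [← map_smul]
  conv_lhs => rw [← Abelian.Ext.mk₀_id_comp α]
  rw [← Abelian.Ext.smul_comp, ← Abelian.Ext.mk₀_smul, smul_id_powQuot 𝔞 hr, Abelian.Ext.mk₀_zero,
    Abelian.Ext.zero_comp, map_zero]

/-- The transition maps R/𝔞ᵐ → R/𝔞ⁿ are surjective, so no nonzero homomorphism dies in the colimit.
-/
lemma ofExt_mk₀_eq_zero_iff {n : ℕ} {M : ModuleCat.{u} R} (f : powQuot 𝔞 n ⟶ M) :
    ofExt 𝔞 0 n M (Abelian.Ext.mk₀ f) = 0 ↔ f = 0 := by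
  refine ⟨fun h => ?_, fun h => by rw [h, Abelian.Ext.mk₀_zero, map_zero]⟩
  obtain ⟨m, hm, h0⟩ := exists_powQuotMap_comp_eq_zero 𝔞 _ h
  rw [Abelian.Ext.mk₀_comp_mk₀, Abelian.Ext.mk₀_eq_zero_iff] at h0
  ext y
  obtain ⟨s, rfl⟩ := Ideal.Quotient.mk_surjective y
  exact congrArg (fun f => f.hom (Ideal.Quotient.mk (𝔞 ^ m) s)) h0

section Vanishing

lemma smul_top_eq_zero_of_map {A B : Type u} [AddCommGroup A] [Module R A] [AddCommGroup B]
    [Module R B] (I : Ideal R) (hB : I • (⊤ : Submodule R B) = ⊥) (f : A →ₗ[R] B) (x : A)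
    (hx : x ∈ I • (⊤ : Submodule R A)) : f x = 0 := by
  have h : f x ∈ (I • (⊤ : Submodule R A)).map f := Submodule.mem_map_of_mem hx
  rw [Submodule.map_smul''] at h
  have h' := smul_mono_right I (le_top (a := (⊤ : Submodule R A).map f)) h
  rwa [hB, Submodule.mem_bot] at h'

lemma mem_smul_top_of_coe_mem {A : Type u} [AddCommGroup A] [Module R A] (I : Ideal R)
    (Y : Submodule R A) (y : Y) (hy : (y : A) ∈ I • Y) : y ∈ I • (⊤ : Submodule R Y) := by
  have hY : I • Y = (I • (⊤ : Submodule R Y)).map Y.subtype := by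
    rw [Submodule.map_smul'', Submodule.map_top, Submodule.range_subtype]
  rw [hY] at hy
  obtain ⟨z, hz, hzy⟩ := hy
  obtain rfl : z = y := Subtype.ext hzy
  exact hz

variable [IsNoetherianRing R]

/-- An extension class with coefficients in a module killed by a power of `𝔞` restricts to zero
along maps whose image is contained in a large enough multiple of the source. -/
theorem exists_mk₀_comp_eq_zero (N : ModuleCat.{u} R) (k : ℕ)
    (hN : 𝔞 ^ k • (⊤ : Submodule R N) = ⊥) (i : ℕ) :
    ∀ (X : ModuleCat.{u} R) [Module.Finite R X] (α : Abelian.Ext.{u} X N i),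
      ∃ m : ℕ, ∀ (Z : ModuleCat.{u} R) (φ : Z ⟶ X),
        (∀ z, φ.hom z ∈ 𝔞 ^ m • (⊤ : Submodule R X)) →
          (Abelian.Ext.mk₀ φ).comp α (zero_add i) = 0 := by
  induction i with
  | zero =>
    intro X _ α
    obtain ⟨f, rfl⟩ := (Abelian.Ext.mk₀_bijective X N).2 α
    refine ⟨k, fun Z φ hφ => ?_⟩
    rw [Abelian.Ext.mk₀_comp_mk₀, Abelian.Ext.mk₀_eq_zero_iff]
    ext z
    exact smul_top_eq_zero_of_map (𝔞 ^ k) hN f.hom _ (hφ z)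
  | succ i ih =>
    intro X _ α
    -- Dimension shifting along 0 → Y → Rʳ → X → 0: `α` comes from a class `β` on `Y`, of degree one
    -- less.
    obtain ⟨r, g, hg⟩ := Module.Finite.exists_fin' R X
    let Y := LinearMap.ker g
    have hS := LinearMap.shortExact_shortComplexKer hg
    obtain ⟨β, hβ⟩ := precomp_extClass_surjective_of_projective_X₂ N hS i α
    have hβα : hS.extClass.comp β (add_comm 1 i) = α := hβ
    obtain ⟨m, hm⟩ := ih (ModuleCat.of R Y) β
    -- Artin–Rees: 𝔞^{m+l}Rʳ ∩ Y ⊆ 𝔞ᵐY, so `β` dies on the kernel of 𝔞^{m+l}Rʳ → 𝔞^{m+l}X.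
    obtain ⟨l, hl⟩ := 𝔞.exists_pow_inf_eq_pow_smul Y
    refine ⟨m + l, fun Z φ hφ => ?_⟩
    let Fm : Submodule R (Fin r → R) := 𝔞 ^ (m + l) • ⊤
    let Xm : Submodule R X := 𝔞 ^ (m + l) • ⊤
    have hmap : Fm.map g = Xm := by
      rw [Submodule.map_smul'', Submodule.map_top, LinearMap.range_eq_top.2 hg]
    let gm : Fm →ₗ[R] Xm := g.restrict fun x hx => hmap ▸ Submodule.mem_map_of_mem hx
    have hgm : Function.Surjective gm := by
      rintro ⟨x, hx⟩
      rw [← hmap] at hx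
      obtain ⟨f, hf, rfl⟩ := hx
      exact ⟨⟨f, hf⟩, rfl⟩
    have hSm := LinearMap.shortExact_shortComplexKer hgm
    let τ₁ : LinearMap.ker gm →ₗ[R] Y :=
      (Fm.subtype ∘ₗ (LinearMap.ker gm).subtype).codRestrict Y fun x =>
        congrArg Subtype.val x.2
    let τ : gm.shortComplexKer ⟶ g.shortComplexKer :=
      { τ₁ := ModuleCat.ofHom τ₁
        τ₂ := ModuleCat.ofHom Fm.subtype
        τ₃ := ModuleCat.ofHom Xm.subtype
        comm₁₂ := rfl
        comm₂₃ := rfl }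
    have h1 : (Abelian.Ext.mk₀ τ.τ₁).comp β (zero_add i) = 0 := by
      refine hm _ τ.τ₁ fun x => ?_
      have hx : (x.1.1 : Fin r → R) ∈ 𝔞 ^ m • Y := by
        have h2 : (x.1.1 : Fin r → R) ∈ 𝔞 ^ (m + l) • ⊤ ⊓ Y := ⟨x.1.2, (τ₁ x).2⟩
        rw [hl (m + l) (by lia), Nat.add_sub_cancel] at h2
        exact (smul_mono_right (𝔞 ^ m) inf_le_right : 𝔞 ^ m • (𝔞 ^ l • ⊤ ⊓ Y) ≤ 𝔞 ^ m • Y) h2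
      exact mem_smul_top_of_coe_mem _ _ (τ₁ x) hx
    have h2 : (Abelian.Ext.mk₀ (ModuleCat.ofHom Xm.subtype : ModuleCat.of R Xm ⟶ X)).comp α
        (zero_add (i + 1)) = 0 := by
      rw [← hβα]
      refine (Abelian.Ext.comp_assoc (Abelian.Ext.mk₀ τ.τ₃) hS.extClass β (zero_add 1)
        (add_comm 1 i) (by lia)).symm.trans ?_
      rw [← ShortComplex.ShortExact.extClass_naturality hSm hS τ,
        Abelian.Ext.comp_assoc _ _ _ (add_zero 1) (zero_add i) (by lia), h1,
        Abelian.Ext.comp_zero]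
    let ψ : Z ⟶ ModuleCat.of R Xm := ModuleCat.ofHom (φ.hom.codRestrict Xm hφ)
    have h3 : φ = ψ ≫ ModuleCat.ofHom Xm.subtype := rfl
    rw [h3, ← Abelian.Ext.mk₀_comp_mk₀, Abelian.Ext.comp_assoc_of_second_deg_zero, h2,
      Abelian.Ext.comp_zero]

/-- The short exact sequence `0 → 𝔞ⁿ → R → R/𝔞ⁿ → 0`. -/
noncomputable abbrev powSequence (n : ℕ) : ShortComplex (ModuleCat.{u} R) :=
  LinearMap.shortComplexKer (Submodule.mkQ (𝔞 ^ n))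

/-- Local cohomology of a module killed by a power of `𝔞` vanishes in positive degrees. -/
theorem eq_zero_of_pow_smul_eq_bot {N : ModuleCat.{u} R} {k : ℕ}
    (hN : 𝔞 ^ k • (⊤ : Submodule R N) = ⊥) (i : ℕ) (y : (localCohomology 𝔞 (i + 1)).obj N) :
    y = 0 := by
  obtain ⟨n, α, rfl⟩ := exists_ofExt 𝔞 y
  have hS (n : ℕ) : (powSequence 𝔞 n).ShortExact :=
    LinearMap.shortExact_shortComplexKer (Submodule.mkQ_surjective _)
  obtain ⟨β, rfl⟩ := precomp_extClass_surjective_of_projective_X₂ N (hS n) i α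
  obtain ⟨m, hm⟩ := exists_mk₀_comp_eq_zero 𝔞 N k hN i _ β
  -- The ideal 𝔞^{m+n} equals 𝔞ᵐ · 𝔞ⁿ, so `β` vanishes on it and the class dies at stage m + n.
  have hle : 𝔞 ^ (m + n) ≤ 𝔞 ^ n := Ideal.pow_le_pow_right (by lia)
  let τ₁ : LinearMap.ker (Submodule.mkQ (𝔞 ^ (m + n))) →ₗ[R]
      LinearMap.ker (Submodule.mkQ (𝔞 ^ n)) :=
    Submodule.inclusion (by simpa using hle)
  let τ : powSequence 𝔞 (m + n) ⟶ powSequence 𝔞 n :=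
    { τ₁ := ModuleCat.ofHom τ₁
      τ₂ := 𝟙 _
      τ₃ := powQuotMap 𝔞 (by lia)
      comm₁₂ := rfl
      comm₂₃ := rfl }
  have h1 : (Abelian.Ext.mk₀ τ.τ₁).comp β (zero_add i) = 0 := by
    refine hm _ τ.τ₁ fun x => ?_
    refine mem_smul_top_of_coe_mem _ _ (τ₁ x) ?_
    have hx : x.1 ∈ 𝔞 ^ (m + n) := (Submodule.Quotient.mk_eq_zero _).1 x.2
    have hpow : 𝔞 ^ (m + n) ≤ 𝔞 ^ m • LinearMap.ker (Submodule.mkQ (𝔞 ^ n)) := by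
      rw [Submodule.ker_mkQ, smul_eq_mul, pow_add]
    exact hpow hx
  have h2 : (Abelian.Ext.mk₀ τ.τ₃).comp
      ((hS n).extClass.comp β (add_comm 1 i)) (zero_add (i + 1)) = 0 := by
    rw [← Abelian.Ext.comp_assoc _ _ _ (zero_add 1) (add_comm 1 i) (by lia),
      ← ShortComplex.ShortExact.extClass_naturality (hS _) (hS n) τ,
      Abelian.Ext.comp_assoc _ _ _ (add_zero 1) (zero_add i) (by lia), h1,
      Abelian.Ext.comp_zero]
  refine (ofExt_powQuotMap 𝔞 (Nat.le_add_left n m) _).symm.trans ?_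
  exact (congrArg _ h2).trans (map_zero _)

end Vanishing

end localCohomology

end LocalCohomologyTorsion

/-! ### Linear lifting along connecting homomorphisms -/

section SplittingOfLocalCohomology

open CategoryTheory

namespace localCohomology

variable {R : Type u} [CommRing R] (𝔞 : Ideal R)
  {A B B' : Type u} [AddCommGroup A] [Module R A] [AddCommGroup B] [Module R B]
  [AddCommGroup B'] [Module R B']

/-- Functoriality of local cohomology, for linear maps. -/
noncomputable def mapHom (i : ℕ) : (A →ₗ[R] B) →ₗ[R]
    (LocalCohomologyModule 𝔞 i A →ₗ[R] LocalCohomologyModule 𝔞 i B) :=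
  (ModuleCat.homLinearEquiv (S := R)).toLinearMap ∘ₗ
    Functor.mapLinearMap R (localCohomology 𝔞 i) ∘ₗ
      (ModuleCat.homLinearEquiv (S := R) (M := ModuleCat.of R A)
        (N := ModuleCat.of R B)).symm.toLinearMap

lemma mapHom_comp (i : ℕ) (f : A →ₗ[R] B) (g : B →ₗ[R] B') (y : LocalCohomologyModule 𝔞 i A) :
    mapHom 𝔞 i (g ∘ₗ f) y = mapHom 𝔞 i g (mapHom 𝔞 i f y) :=
  congrArg (fun h => h.hom y) ((localCohomology 𝔞 i).map_comp (ModuleCat.ofHom f)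
    (ModuleCat.ofHom g))

@[simp] lemma mapHom_id (i : ℕ) (y : LocalCohomologyModule 𝔞 i A) :
    mapHom 𝔞 i (LinearMap.id : A →ₗ[R] A) y = y :=
  congrArg (fun h => h.hom y) ((localCohomology 𝔞 i).map_id (ModuleCat.of R A))

lemma mapHom_smul_id (i : ℕ) (r : R) (y : LocalCohomologyModule 𝔞 i A) :
    mapHom 𝔞 i (r • (LinearMap.id : A →ₗ[R] A)) y = r • y := by
  rw [map_smul, LinearMap.smul_apply, mapHom_id]

section TorsionQuotient

variable [IsNoetherianRing R] {k : ℕ} (K : Submodule R A)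
  (hK : 𝔞 ^ k • (⊤ : Submodule R K) = ⊥)

omit [IsNoetherianRing R] in
lemma subtype_mkQ_shortExact : (ShortComplex.mk (ModuleCat.ofHom K.subtype)
    (ModuleCat.ofHom K.mkQ) (by ext x; simp)).ShortExact :=
  ModuleCat.shortComplex_shortExact _ (LinearMap.exact_subtype_mkQ K)
    K.injective_subtype K.mkQ_surjective

include hK

lemma mapHom_mkQ_surjective (i : ℕ) : Function.Surjective (mapHom 𝔞 i K.mkQ) := by
  intro y
  exact (exact_map_δ 𝔞 (subtype_mkQ_shortExact K) i y).1
    (eq_zero_of_pow_smul_eq_bot 𝔞 (N := ModuleCat.of R K) hK i _)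

/-- Degree zero is excluded because H^0(K) = K need not vanish. -/
lemma mapHom_mkQ_injective (i : ℕ) : Function.Injective (mapHom 𝔞 (i + 1) K.mkQ) := by
  rw [injective_iff_map_eq_zero]
  intro y hy
  obtain ⟨z, rfl⟩ := (exact_map_map 𝔞 (subtype_mkQ_shortExact K) (i + 1) y).1 hy
  rw [eq_zero_of_pow_smul_eq_bot 𝔞 (N := ModuleCat.of R K) hK i z, map_zero]

end TorsionQuotient

section QuotientSequence

/-- The short complex `A / ker f → B → B / im f`. -/
noncomputable abbrev quotientSequence (f : A →ₗ[R] B) : ShortComplex (ModuleCat.{u} R) where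
  f := ModuleCat.ofHom ((LinearMap.ker f).liftQ f le_rfl)
  g := ModuleCat.ofHom (LinearMap.range f).mkQ
  zero := by
    ext x
    simp

lemma quotientSequence_shortExact (f : A →ₗ[R] B) : (quotientSequence f).ShortExact := by
  refine ModuleCat.shortComplex_shortExact _ ?_ ?_ (Submodule.mkQ_surjective _)
  · change Function.Exact ((LinearMap.ker f).liftQ f le_rfl) (LinearMap.range f).mkQ
    rw [LinearMap.exact_iff, Submodule.ker_mkQ, Submodule.range_liftQ]
  · exact LinearMap.ker_eq_bot.1 (Submodule.ker_liftQ_eq_bot _ _ _ le_rfl)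

/-- The connecting homomorphism of `quotientSequence f`. -/
noncomputable def quotientδ (f : A →ₗ[R] B) (i : ℕ) :
    LocalCohomologyModule 𝔞 i (B ⧸ LinearMap.range f) →ₗ[R]
      LocalCohomologyModule 𝔞 (i + 1) (A ⧸ LinearMap.ker f) :=
  δ 𝔞 (quotientSequence_shortExact f) i

variable (f : A →ₗ[R] B) (i : ℕ)

lemma exact_mapHom_quotientδ :
    Function.Exact (mapHom 𝔞 i (LinearMap.range f).mkQ) (quotientδ 𝔞 f i) :=
  exact_map_δ 𝔞 (quotientSequence_shortExact f) i

lemma exact_liftQ_mkQ :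
    Function.Exact (mapHom 𝔞 i ((LinearMap.ker f).liftQ f le_rfl))
      (mapHom 𝔞 i (LinearMap.range f).mkQ) :=
  exact_map_map 𝔞 (quotientSequence_shortExact f) i

lemma exact_quotientδ_liftQ :
    Function.Exact (quotientδ 𝔞 f i) (mapHom 𝔞 (i + 1) ((LinearMap.ker f).liftQ f le_rfl)) :=
  exact_δ_map 𝔞 (quotientSequence_shortExact f) i

lemma mapHom_liftQ_mkQ (y : LocalCohomologyModule 𝔞 i A) :
    mapHom 𝔞 i ((LinearMap.ker f).liftQ f le_rfl) (mapHom 𝔞 i (LinearMap.ker f).mkQ y) =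
      mapHom 𝔞 i f y := by
  rw [← mapHom_comp, Submodule.liftQ_mkQ]

lemma ker_le_ker_of_comp_eq {f : A →ₗ[R] B} {f' : A →ₗ[R] B'} {b : B →ₗ[R] B'}
    (h : b ∘ₗ f = f') : LinearMap.ker f ≤ LinearMap.ker f' := h ▸ LinearMap.ker_le_ker_comp f b

lemma range_le_comap_of_comp_eq {f : A →ₗ[R] B} {f' : A →ₗ[R] B'} {b : B →ₗ[R] B'}
    (h : b ∘ₗ f = f') : LinearMap.range f ≤ (LinearMap.range f').comap b := by
  rintro _ ⟨x, rfl⟩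
  exact ⟨x, by rw [← h]; rfl⟩

lemma quotientδ_naturality {f : A →ₗ[R] B} {f' : A →ₗ[R] B'} {b : B →ₗ[R] B'} (h : b ∘ₗ f = f')
    (i : ℕ) (y : LocalCohomologyModule 𝔞 i (B ⧸ LinearMap.range f)) :
    quotientδ 𝔞 f' i (mapHom 𝔞 i (Submodule.mapQ _ _ b (range_le_comap_of_comp_eq h)) y) =
      mapHom 𝔞 (i + 1) (Submodule.factor (ker_le_ker_of_comp_eq h)) (quotientδ 𝔞 f i y) :=
  δ_naturality 𝔞 (quotientSequence_shortExact f) (quotientSequence_shortExact f')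
    { τ₁ := ModuleCat.ofHom (Submodule.factor (ker_le_ker_of_comp_eq h))
      τ₂ := ModuleCat.ofHom b
      τ₃ := ModuleCat.ofHom (Submodule.mapQ _ _ b (range_le_comap_of_comp_eq h))
      comm₁₂ := by
        ext x
        exact (LinearMap.congr_fun h x).symm
      comm₂₃ := rfl } i y

end QuotientSequence

section Lifting

variable (i : ℕ)

/-- If `f' = b ∘ f`, where `b` vanishes on local cohomology in degree `i` and `f` vanishes on a
submodule of local cohomology in degree `i + 1`, then that submodule lifts linearly along the
connecting homomorphism of `f'`. -/
lemma exists_quotientδ_lift {f : A →ₗ[R] B} {f' : A →ₗ[R] B'} {b : B →ₗ[R] B'} (h : b ∘ₗ f = f')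
    (hb : mapHom 𝔞 i b = 0) (T : Submodule R (LocalCohomologyModule 𝔞 (i + 1) A))
    (hT : ∀ ξ ∈ T, mapHom 𝔞 (i + 1) f ξ = 0) :
    ∃ s : T →ₗ[R] LocalCohomologyModule 𝔞 i (B' ⧸ LinearMap.range f'),
      ∀ ξ : T, quotientδ 𝔞 f' i (s ξ) = mapHom 𝔞 (i + 1) (LinearMap.ker f').mkQ ξ := by
  have hex (ξ : T) : ∃ η, quotientδ 𝔞 f i η = mapHom 𝔞 (i + 1) (LinearMap.ker f).mkQ ξ :=
    (exact_quotientδ_liftQ 𝔞 f i _).1 ((mapHom_liftQ_mkQ 𝔞 f (i + 1) _).trans (hT ξ ξ.2))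
  choose η hη using hex
  let b' := Submodule.mapQ _ _ b (range_le_comap_of_comp_eq h)
  -- Lifts `η` are unique up to the image of H^i(B), which `b` kills; pushing forward along `b'`
  -- therefore turns arbitrary choices into a linear map.
  have hb' (y : LocalCohomologyModule 𝔞 i (B ⧸ LinearMap.range f))
      (hy : quotientδ 𝔞 f i y = 0) : mapHom 𝔞 i b' y = 0 := by
    obtain ⟨w, rfl⟩ := (exact_mapHom_quotientδ 𝔞 f i y).1 hy
    rw [← mapHom_comp]
    have : b' ∘ₗ (LinearMap.range f).mkQ = (LinearMap.range f').mkQ ∘ₗ b := rfl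
    rw [this, mapHom_comp, hb, LinearMap.zero_apply, map_zero]
  let s : T →ₗ[R] LocalCohomologyModule 𝔞 i (B' ⧸ LinearMap.range f') :=
    { toFun := fun ξ => mapHom 𝔞 i b' (η ξ)
      map_add' := fun ξ ξ' => by
        rw [← sub_eq_zero, ← map_add, ← map_sub]
        apply hb'
        simp [hη]
      map_smul' := fun r ξ => by
        rw [← sub_eq_zero, RingHom.id_apply, ← map_smul, ← map_sub]
        apply hb'
        simp [hη] }
  refine ⟨s, fun ξ => ?_⟩
  have hs : s ξ = mapHom 𝔞 i b' (η ξ) := rfl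
  have hc : Submodule.factor (ker_le_ker_of_comp_eq h) ∘ₗ (LinearMap.ker f).mkQ =
      (LinearMap.ker f').mkQ := rfl
  rw [hs, quotientδ_naturality 𝔞 h i (η ξ), hη, ← mapHom_comp, hc]

end Lifting

end localCohomology

end SplittingOfLocalCohomology

/-! ### Multiplication by an element of `I * I` -/

section FilterRegularMultiplication

open CategoryTheory

namespace localCohomology

variable {R : Type u} [CommRing R]

lemma exists_sum_mul_of_mem_mul {I J : Ideal R} {x : R} (hx : x ∈ I * J) :
    ∃ (ι : Type) (_ : Fintype ι) (a b : ι → R), (∀ k, a k ∈ I) ∧ (∀ k, b k ∈ J) ∧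
      x = ∑ k, b k * a k := by
  induction hx using Submodule.mul_induction_on' with
  | mem_mul_mem m hm n hn =>
    exact ⟨Unit, inferInstance, fun _ => m, fun _ => n, fun _ => hm, fun _ => hn,
      by simp [mul_comm]⟩
  | add y _ z _ hy hz =>
    obtain ⟨ι, _, a, b, ha, hb, rfl⟩ := hy
    obtain ⟨κ, _, c, d, hc, hd, rfl⟩ := hz
    exact ⟨ι ⊕ κ, inferInstance, Sum.elim a c, Sum.elim b d, by rintro (k | k) <;> simp [ha, hc],
      by rintro (k | k) <;> simp [hb, hd], by simp⟩

variable (𝔞 : Ideal R) {M : Type u} [AddCommGroup M] [Module R M]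

/-- The elements of local cohomology killed by an ideal. -/
def killedBy (I : Ideal R) (i : ℕ) (M : Type u) [AddCommGroup M] [Module R M] :
    Submodule R (LocalCohomologyModule 𝔞 i M) where
  carrier := {ξ | ∀ r ∈ I, r • ξ = 0}
  add_mem' hξ hη r hr := by rw [smul_add, hξ r hr, hη r hr, add_zero]
  zero_mem' _ _ := smul_zero _
  smul_mem' c ξ hξ r hr := by rw [smul_comm, hξ r hr, smul_zero]

variable {I : Ideal R} {x : R} (hx : x ∈ I * I) {i : ℕ}

-- Multiplication by `x = ∑ b_k a_k` factors through `ι → M`: the a_k kill the `I`-torsion in degree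
-- i + 1, the b_k kill everything in degree i.
include hx in
lemma exists_smul_lift (hI : killedBy 𝔞 I i M = ⊤) :
    ∃ s : killedBy 𝔞 I (i + 1) M →ₗ[R]
        LocalCohomologyModule 𝔞 i (M ⧸ LinearMap.range (x • (LinearMap.id : M →ₗ[R] M))),
      ∀ ξ, quotientδ 𝔞 (x • (LinearMap.id : M →ₗ[R] M)) i (s ξ) =
        mapHom 𝔞 (i + 1) (LinearMap.ker (x • (LinearMap.id : M →ₗ[R] M))).mkQ ξ := by
  classical
  obtain ⟨ι, _, a, b, ha, hb, rfl⟩ := exists_sum_mul_of_mem_mul hx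
  let f : M →ₗ[R] (ι → M) := ∑ k, a k • LinearMap.single R (fun _ => M) k
  let g : (ι → M) →ₗ[R] M := ∑ k, b k • LinearMap.proj k
  have hgf : g ∘ₗ f = (∑ k, b k * a k) • LinearMap.id := by
    ext m
    simp [f, g, Finset.sum_apply, Pi.single_apply, Finset.sum_smul, mul_smul]
  refine exists_quotientδ_lift 𝔞 i hgf ?_ _ fun ξ hξ => ?_
  · ext y
    rw [map_sum, LinearMap.sum_apply, LinearMap.zero_apply]
    refine Finset.sum_eq_zero fun k _ => ?_
    rw [map_smul, LinearMap.smul_apply]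
    exact (hI ▸ Submodule.mem_top : mapHom 𝔞 i (LinearMap.proj k) y ∈ killedBy 𝔞 I i M) _ (hb k)
  · rw [map_sum, LinearMap.sum_apply]
    refine Finset.sum_eq_zero fun k _ => ?_
    rw [map_smul, LinearMap.smul_apply, ← map_smul, hξ _ (ha k), map_zero]

variable [IsNoetherianRing R] {k : ℕ}
  (hK : 𝔞 ^ k • (⊤ : Submodule R (LinearMap.ker (x • (LinearMap.id : M →ₗ[R] M)))) = ⊥)

include hx hK

/-- The kernel is the image of H^i(M/ker x). Classes there lift to H^i(M), so their images are
multiples by `x`, hence zero. -/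
lemma mapHom_mkQ_range_injective (hI : killedBy 𝔞 I i M = ⊤) :
    Function.Injective
      (mapHom 𝔞 i (LinearMap.range (x • (LinearMap.id : M →ₗ[R] M))).mkQ) := by
  rw [injective_iff_map_eq_zero]
  intro y hy
  obtain ⟨z, rfl⟩ := (exact_liftQ_mkQ 𝔞 _ i y).1 hy
  obtain ⟨w, rfl⟩ := mapHom_mkQ_surjective 𝔞 _ hK i z
  rw [mapHom_liftQ_mkQ, mapHom_smul_id]
  exact (hI ▸ Submodule.mem_top : w ∈ killedBy 𝔞 I i M) _ (Ideal.mul_le_left hx)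

/-- Every class is the image of one from H^i(M) plus a lift under `s` of one from H^{i+1}(M); `I`
kills both summands. -/
lemma killedBy_quotient_eq_top (hI : killedBy 𝔞 I i M = ⊤) (hI' : killedBy 𝔞 I (i + 1) M = ⊤) :
    killedBy 𝔞 I i (M ⧸ LinearMap.range (x • (LinearMap.id : M →ₗ[R] M))) = ⊤ := by
  obtain ⟨s, hs⟩ := exists_smul_lift 𝔞 hx hI
  rw [eq_top_iff]
  intro y _ r hr
  obtain ⟨ξ, hξ⟩ := mapHom_mkQ_surjective 𝔞 _ hK (i + 1) (quotientδ 𝔞 _ i y)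
  have hξT : ξ ∈ killedBy 𝔞 I (i + 1) M := hI' ▸ Submodule.mem_top
  have h0 : quotientδ 𝔞 (x • (LinearMap.id : M →ₗ[R] M)) i (y - s ⟨ξ, hξT⟩) = 0 := by
    rw [map_sub, hs, ← hξ, sub_self]
  obtain ⟨z, hz⟩ := (exact_mapHom_quotientδ 𝔞 _ i _).1 h0
  have hy : y = mapHom 𝔞 i (LinearMap.range (x • (LinearMap.id : M →ₗ[R] M))).mkQ z +
      s ⟨ξ, hξT⟩ := by rw [hz, sub_add_cancel]
  have h1 : r • (⟨ξ, hξT⟩ : killedBy 𝔞 I (i + 1) M) = 0 := Subtype.ext (hξT r hr)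
  rw [hy, smul_add, ← map_smul, ← map_smul, h1, map_zero, add_zero,
    (hI ▸ Submodule.mem_top : z ∈ killedBy 𝔞 I i M) r hr, map_zero]

lemma associatedPrimes_quotient_eq_union (hI𝔞 : I ≤ 𝔞) (hI : killedBy 𝔞 I i M = ⊤) :
    associatedPrimes R (LocalCohomologyModule 𝔞 i
        (M ⧸ LinearMap.range (x • (LinearMap.id : M →ₗ[R] M)))) =
      associatedPrimes R (LocalCohomologyModule 𝔞 i M) ∪
        associatedPrimes R (LocalCohomologyModule 𝔞 (i + 1) M) := by
  have hinj := mapHom_mkQ_range_injective 𝔞 hx hK hI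
  have hinj' := mapHom_mkQ_injective 𝔞 _ hK i
  refine subset_antisymm ?_ (Set.union_subset (associatedPrimes.subset_of_injective hinj) ?_)
  · refine (associatedPrimes.subset_union_of_exact hinj
      (exact_mapHom_quotientδ 𝔞 _ i)).trans (Set.union_subset_union_right _ ?_)
    exact (LinearEquiv.AssociatedPrimes.eq (LinearEquiv.ofBijective _
      ⟨hinj', mapHom_mkQ_surjective 𝔞 _ hK (i + 1)⟩)).ge
  · intro p hp
    obtain ⟨hpp, ξ, hξ⟩ := isAssociatedPrime_iff.1 hp
    have hmem (r : R) : r ∈ p ↔ r • ξ = 0 := by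
      rw [hξ, Submodule.mem_colon_singleton, Submodule.mem_bot]
    obtain ⟨n, hn⟩ := exists_pow_smul_eq_zero 𝔞 ξ
    have hap : 𝔞 ≤ p := hpp.le_of_pow_le (n := n) fun r hr => (hmem r).2 (hn r hr)
    -- Since `I ≤ 𝔞 ≤ p`, the class `ξ` lies where the lift `s` is defined; `s` is injective there,
    -- so it preserves the annihilator.
    have hξT : ξ ∈ killedBy 𝔞 I (i + 1) M := fun r hr => (hmem r).1 (hap (hI𝔞 hr))
    obtain ⟨s, hs⟩ := exists_smul_lift 𝔞 hx hI
    refine isAssociatedPrime_iff.2 ⟨hpp, s ⟨ξ, hξT⟩, ?_⟩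
    ext r
    rw [hmem, Submodule.mem_colon_singleton, Submodule.mem_bot, ← map_smul]
    constructor
    · intro h
      have h1 : r • (⟨ξ, hξT⟩ : killedBy 𝔞 I (i + 1) M) = 0 := Subtype.ext h
      rw [h1, map_zero]
    · intro h
      have h1 := hs (r • ⟨ξ, hξT⟩)
      rw [h, map_zero] at h1
      exact (injective_iff_map_eq_zero _).1 hinj' _ h1.symm

end localCohomology

end FilterRegularMultiplication

/-! ### Filter regular sequences and the induction -/

section FilterRegularSequences

open CategoryTheory

variable {R : Type u} [CommRing R] (𝔞 : Ideal R)

/-- The generator of `R / 𝔞ⁿ`. -/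
noncomputable def localCohomology.powQuotOne (n : ℕ) : powQuot 𝔞 n :=
  Submodule.Quotient.mk (p := 𝔞 ^ n) (1 : R)

lemma localCohomology.exists_smul_powQuotOne (n : ℕ) (y : powQuot 𝔞 n) :
    ∃ s : R, s • powQuotOne 𝔞 n = y := by
  obtain ⟨s, rfl⟩ := Submodule.Quotient.mk_surjective (𝔞 ^ n) y
  refine ⟨s, ?_⟩
  change Submodule.Quotient.mk (p := 𝔞 ^ n) (s • 1) = _
  rw [smul_eq_mul, mul_one]

/-- The associated primes of the zeroth local cohomology. -/
theorem localCohomology.associatedPrimes_zero [IsNoetherianRing R] (M : Type u) [AddCommGroup M]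
    [Module R M] :
    associatedPrimes R (LocalCohomologyModule 𝔞 0 M) =
      associatedPrimes R M ∩ {𝔭 : Ideal R | 𝔭.IsPrime ∧ 𝔞 ≤ 𝔭} := by
  -- A degree-zero class is a map from R/𝔞ⁿ, and its annihilator is that of the image of 1.
  have key (n : ℕ) (f : powQuot 𝔞 n ⟶ ModuleCat.of R M) (r : R) :
      r • ofExt 𝔞 0 n _ (Abelian.Ext.mk₀ f) = 0 ↔
        r • (f.hom (powQuotOne 𝔞 n) : M) = 0 := by
    rw [← map_smul, ← Abelian.Ext.mk₀_smul, ofExt_mk₀_eq_zero_iff]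
    constructor
    · intro h
      exact congrArg (fun g => g.hom (powQuotOne 𝔞 n)) h
    · intro h
      ext y
      obtain ⟨s, rfl⟩ := exists_smul_powQuotOne 𝔞 n y
      change r • f.hom (s • powQuotOne 𝔞 n) = 0
      rw [LinearMap.map_smul, smul_comm, h, smul_zero]
  ext p
  constructor
  · intro hp
    obtain ⟨hpp, ξ, hξ⟩ := isAssociatedPrime_iff.1 hp
    obtain ⟨n, α, rfl⟩ := exists_ofExt 𝔞 ξ
    obtain ⟨f, rfl⟩ := (Abelian.Ext.mk₀_bijective _ _).2 α
    have hmem (r : R) : r ∈ p ↔ r • (f.hom (powQuotOne 𝔞 n) : M) = 0 := by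
      rw [hξ, Submodule.mem_colon_singleton, Submodule.mem_bot, key]
    refine ⟨isAssociatedPrime_iff.2 ⟨hpp, f.hom (powQuotOne 𝔞 n), ?_⟩, hpp, ?_⟩
    · ext r
      rw [hmem, Submodule.mem_colon_singleton, Submodule.mem_bot]
    · refine hpp.le_of_pow_le (n := n) fun r hr => (hmem r).2 ?_
      have := congrArg (fun g => f.hom (g.hom (powQuotOne 𝔞 n))) (smul_id_powQuot 𝔞 hr)
      refine Eq.trans ?_ (this.trans (map_zero f.hom))
      exact (f.hom.map_smul r _).symm
  · rintro ⟨hp, hpp, hap⟩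
    obtain ⟨-, m, hm⟩ := isAssociatedPrime_iff.1 hp
    have hmem (r : R) : r ∈ p ↔ r • m = 0 := by
      rw [hm, Submodule.mem_colon_singleton, Submodule.mem_bot]
    let f : R ⧸ 𝔞 ^ 1 →ₗ[R] M := Submodule.liftQ _ (LinearMap.toSpanSingleton R M m) (by
      rw [pow_one]
      exact fun r hr => (hmem r).1 (hap hr))
    let F : powQuot 𝔞 1 ⟶ ModuleCat.of R M := ModuleCat.ofHom f
    have hF : F.hom (powQuotOne 𝔞 1) = m := one_smul R m
    refine isAssociatedPrime_iff.2 ⟨hpp, ofExt 𝔞 0 1 (ModuleCat.of R M) (Abelian.Ext.mk₀ F), ?_⟩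
    ext r
    rw [Submodule.mem_colon_singleton, Submodule.mem_bot, key, hmem, hF]

variable {𝔞} {M : Type u} [AddCommGroup M] [Module R M]

/-- The kernel of multiplication by a filter regular element is killed by a power of `𝔞`. -/
lemma IsFilterRegularElement.exists_pow_smul_ker_eq_bot [IsNoetherianRing R] [Module.Finite R M]
    {x : R} (hx : IsFilterRegularElement 𝔞 M x) : ∃ k : ℕ,
      𝔞 ^ k • (⊤ : Submodule R (LinearMap.ker (x • (LinearMap.id : M →ₗ[R] M)))) = ⊥ := by
  let K := LinearMap.ker (x • (LinearMap.id : M →ₗ[R] M))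
  have hrad : 𝔞 ≤ (Module.annihilator R K).radical := by
    rw [← Ideal.sInf_minimalPrimes]
    -- A minimal prime over the annihilator of `K` is associated to `K`, hence to `M`, and contains
    -- `x`; filter regularity then forces `𝔞 ≤ p`.
    refine le_sInf fun p hp => ?_
    by_contra hap
    have hpK := Module.associatedPrimes.minimalPrimes_annihilator_subset_associatedPrimes R K hp
    refine hx.2 p (associatedPrimes.subset_of_injective K.injective_subtype hpK) hap (hp.1.2 ?_)
    rw [Module.mem_annihilator]
    rintro ⟨m, hm⟩
    exact Subtype.ext hm
  obtain ⟨k, hk⟩ := Ideal.exists_pow_le_of_le_radical_of_fg hrad (IsNoetherian.noetherian 𝔞)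
  refine ⟨k, eq_bot_iff.2 (Submodule.smul_le.2 fun r hr m _ => ?_)⟩
  exact Module.mem_annihilator.1 (hk hr) m

lemma IsFilterRegularElement.congr {N : Type u} [AddCommGroup N] [Module R N] (e : M ≃ₗ[R] N)
    {x : R} : IsFilterRegularElement 𝔞 M x ↔ IsFilterRegularElement 𝔞 N x := by
  rw [IsFilterRegularElement, IsFilterRegularElement, LinearEquiv.AssociatedPrimes.eq e]

/-- Dividing out the empty part of a sequence changes nothing. -/
noncomputable def quotientInitialZeroEquiv {t : ℕ} (x : Fin t → R) :
    (M ⧸ initialSubmodule M x 0) ≃ₗ[R] M :=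
  Submodule.quotEquivOfEqBot _ (by simp [initialSubmodule])

lemma initialSubmodule_succ {t : ℕ} (x : Fin (t + 1) → R) (j : ℕ) :
    initialSubmodule M x (j + 1) = LinearMap.range (x 0 • (LinearMap.id : M →ₗ[R] M)) ⊔
      initialSubmodule M (Fin.tail x) j := by
  have hset : x '' {k | (k : ℕ) < j + 1} = {x 0} ∪ Fin.tail x '' {k | (k : ℕ) < j} := by
    ext r
    simp only [Set.mem_image, Set.mem_ofPred_eq, Set.mem_union, Set.mem_singleton_iff, Fin.tail]
    rw [Fin.exists_fin_succ]
    simp [eq_comm]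
  have hrange : Ideal.span {x 0} • (⊤ : Submodule R M) =
      LinearMap.range (x 0 • (LinearMap.id : M →ₗ[R] M)) := by
    ext m
    simp [Submodule.ideal_span_singleton_smul, Submodule.mem_smul_pointwise_iff_exists]
  rw [initialSubmodule, hset, Ideal.span_union, Submodule.sup_smul, hrange, initialSubmodule]

/-- Dividing out a sequence can be done by first dividing out its first term. -/
noncomputable def quotientInitialSuccEquiv {t : ℕ} (x : Fin (t + 1) → R) (j : ℕ) :
    ((M ⧸ LinearMap.range (x 0 • (LinearMap.id : M →ₗ[R] M))) ⧸
      initialSubmodule (M ⧸ LinearMap.range (x 0 • (LinearMap.id : M →ₗ[R] M))) (Fin.tail x) j)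
      ≃ₗ[R] M ⧸ initialSubmodule M x (j + 1) :=
  Submodule.quotEquivOfEq _ _ (by
    rw [initialSubmodule, initialSubmodule, Submodule.map_smul'', Submodule.map_top,
      Submodule.range_mkQ]) ≪≫ₗ
  Submodule.quotientQuotientEquivQuotientSup _ (initialSubmodule M (Fin.tail x) j) ≪≫ₗ
    Submodule.quotEquivOfEq _ _ (initialSubmodule_succ x j).symm

lemma isFilterRegularSequence_succ_iff {t : ℕ} (x : Fin (t + 1) → R) :
    IsFilterRegularSequence 𝔞 M x ↔ IsFilterRegularElement 𝔞 M (x 0) ∧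
      IsFilterRegularSequence 𝔞 (M ⧸ LinearMap.range (x 0 • (LinearMap.id : M →ₗ[R] M)))
        (Fin.tail x) := by
  rw [IsFilterRegularSequence, Fin.forall_fin_succ]
  refine and_congr (IsFilterRegularElement.congr (quotientInitialZeroEquiv x)) ?_
  exact forall_congr' fun k => (IsFilterRegularElement.congr (quotientInitialSuccEquiv x k)).symm

/-- Prime avoidance: only finitely many associated primes fail to contain `𝔞`, and none of these
contains a power of `𝔞`. -/
lemma exists_isFilterRegularElement [IsNoetherianRing R] (M : Type u) [AddCommGroup M]
    [Module R M] [Module.Finite R M] {m : ℕ} (hm : m ≠ 0) :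
    ∃ x ∈ 𝔞 ^ m, IsFilterRegularElement 𝔞 M x := by
  have hfin : {p ∈ associatedPrimes R M | ¬ 𝔞 ≤ p}.Finite :=
    (associatedPrimes.finite R M).subset (Set.sep_subset _ _)
  by_contra! h
  have hsub : ((𝔞 ^ m : Ideal R) : Set R) ⊆ ⋃ p ∈ (hfin.toFinset : Set (Ideal R)), (p : Set R) := by
    intro x hx
    have h1 := h x hx
    simp only [IsFilterRegularElement, not_and, not_forall, not_not] at h1
    obtain ⟨p, hp, hap, hxp⟩ := h1 (Ideal.pow_le_self hm hx)
    simp only [Set.mem_iUnion]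
    exact ⟨p, by simpa using ⟨hp, hap⟩, hxp⟩
  -- The two indices exempt from primality are arbitrary here, as all the ideals are prime.
  obtain ⟨p, hp, hle⟩ := (Ideal.subset_union_prime ⊥ ⊥ fun p hp _ _ =>
    ((hfin.mem_toFinset.1 hp).1 : IsAssociatedPrime p M).isPrime).1 hsub
  have hp' := hfin.mem_toFinset.1 hp
  exact hp'.2 ((hp'.1 : IsAssociatedPrime p M).isPrime.le_of_pow_le hle)

lemma exists_isFilterRegularSequence [IsNoetherianRing R] {m : ℕ} (hm : m ≠ 0) (t : ℕ) :
    ∀ (M : Type u) [AddCommGroup M] [Module R M] [Module.Finite R M],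
      ∃ x : Fin t → R, IsFilterRegularSequence 𝔞 M x ∧ ∀ k, x k ∈ 𝔞 ^ m := by
  induction t with
  | zero => exact fun M _ _ _ => ⟨Fin.elim0, fun k => k.elim0, fun k => k.elim0⟩
  | succ t ih =>
    intro M _ _ _
    obtain ⟨y, hy, hreg⟩ := exists_isFilterRegularElement (𝔞 := 𝔞) M hm
    obtain ⟨x, hx, hmem⟩ := ih (M ⧸ LinearMap.range (y • (LinearMap.id : M →ₗ[R] M)))
    exact ⟨Fin.cons y x, (isFilterRegularSequence_succ_iff _).2 ⟨hreg, hx⟩,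
      Fin.cases hy hmem⟩

/-- `M` and `t` vary in the induction: dividing out the first term shortens the sequence and costs
one degree of the annihilation hypothesis. -/
theorem associatedPrimes_quotient_initialSubmodule [IsNoetherianRing R] {I : Ideal R}
    (hI𝔞 : I ≤ 𝔞) (j : ℕ) : ∀ (M : Type u) [AddCommGroup M] [Module R M] [Module.Finite R M]
      {t : ℕ} (x : Fin t → R), (∀ i < t, localCohomology.killedBy 𝔞 I i M = ⊤) →
      IsFilterRegularSequence 𝔞 M x → (∀ k, x k ∈ I * I) → j ≤ t →
        (⋃ i : ℕ, ⋃ _ : i ≤ j, associatedPrimes R (LocalCohomologyModule 𝔞 i M)) =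
          associatedPrimes R (M ⧸ initialSubmodule M x j) ∩
            {𝔭 : Ideal R | 𝔭.IsPrime ∧ 𝔞 ≤ 𝔭} := by
  induction j with
  | zero =>
    intro M _ _ _ t x _ _ _ _
    rw [LinearEquiv.AssociatedPrimes.eq (quotientInitialZeroEquiv x),
      ← localCohomology.associatedPrimes_zero]
    simp
  | succ j ih =>
    intro M _ _ _ t x hkill hreg hmem hj
    obtain ⟨t, rfl⟩ := Nat.exists_eq_add_one_of_ne_zero (by lia : t ≠ 0)
    obtain ⟨h0, htail⟩ := (isFilterRegularSequence_succ_iff x).1 hreg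
    obtain ⟨k, hk⟩ := h0.exists_pow_smul_ker_eq_bot
    rw [← LinearEquiv.AssociatedPrimes.eq (quotientInitialSuccEquiv x j),
      ← ih _ (Fin.tail x) (fun i hi => localCohomology.killedBy_quotient_eq_top 𝔞 (hmem 0) hk
        (hkill i (by lia)) (hkill (i + 1) (by lia))) htail (fun k => hmem k.succ) (by lia)]
    have hunion (i : ℕ) (hi : i ≤ j) :=
      localCohomology.associatedPrimes_quotient_eq_union 𝔞 (hmem 0) hk hI𝔞 (hkill i (by lia))
    ext p
    simp only [Set.mem_iUnion, exists_prop]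
    constructor
    · rintro ⟨i, hi, hp⟩
      rcases i with _ | i
      -- Degree i of the quotient accounts for degrees i and i + 1 of `M`; only degree 0 needs the
      -- left half of the union.
      · exact ⟨0, by lia, by rw [hunion 0 (by lia)]; exact Or.inl hp⟩
      · exact ⟨i, by lia, by rw [hunion i (by lia)]; exact Or.inr hp⟩
    · rintro ⟨i, hi, hp⟩
      rw [hunion i hi] at hp
      rcases hp with hp | hp
      · exact ⟨i, by lia, hp⟩
      · exact ⟨i + 1, by lia, hp⟩

end FilterRegularSequences

theorem corollary4p4 {R : Type u} [CommRing R] [IsNoetherianRing R]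
    (M : Type u) [AddCommGroup M] [Module R M] [Module.Finite R M]
    (𝔞 : Ideal R) (t n₀ : ℕ) (ht : 0 < t) (hn₀ : 0 < n₀)
    (hann : ∀ i : ℕ, i < t →
      𝔞 ^ n₀ • (⊤ : Submodule R (LocalCohomologyModule 𝔞 i M)) = ⊥) :
    (∀ x : Fin t → R, IsFilterRegularSequence 𝔞 M x → (∀ k : Fin t, x k ∈ 𝔞 ^ (2 * n₀)) →
      ∀ j : ℕ, 1 ≤ j → j ≤ t →
        (⋃ i : ℕ, ⋃ _ : i ≤ j, associatedPrimes R (LocalCohomologyModule 𝔞 i M)) =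
          associatedPrimes R (M ⧸ initialSubmodule M x j) ∩ {𝔭 : Ideal R | 𝔭.IsPrime ∧ 𝔞 ≤ 𝔭}) ∧
    (associatedPrimes R (LocalCohomologyModule 𝔞 t M)).Finite := by
  have hkill (i : ℕ) (hi : i < t) : localCohomology.killedBy 𝔞 (𝔞 ^ n₀) i M = ⊤ := by
    refine eq_top_iff.2 fun y _ r hr => ?_
    have h := Submodule.smul_mem_smul hr (Submodule.mem_top (x := y))
    rwa [hann i hi, Submodule.mem_bot] at h
  have hpow : 𝔞 ^ (2 * n₀) = 𝔞 ^ n₀ * 𝔞 ^ n₀ := by rw [two_mul, pow_add]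
  have hmain (x : Fin t → R) (hx : IsFilterRegularSequence 𝔞 M x)
      (hmem : ∀ k : Fin t, x k ∈ 𝔞 ^ (2 * n₀)) (j : ℕ) (hj : j ≤ t) :=
    associatedPrimes_quotient_initialSubmodule (Ideal.pow_le_self hn₀.ne') j M x hkill hx
      (fun k => hpow ▸ hmem k) hj
  refine ⟨fun x hx hmem j _ hj => hmain x hx hmem j hj, ?_⟩
  -- Finiteness needs one suitable sequence: the equality at j = t puts Ass H^t(M) inside the
  -- associated primes of a finitely generated module.
  obtain ⟨x, hx, hmem⟩ := exists_isFilterRegularSequence (𝔞 := 𝔞) (m := 2 * n₀) (by lia) t M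
  have hfin : (associatedPrimes R (M ⧸ initialSubmodule M x t)).Finite :=
    associatedPrimes.finite R _
  refine (hfin.inter_of_left {𝔭 : Ideal R | 𝔭.IsPrime ∧ 𝔞 ≤ 𝔭}).subset ?_
  rw [← hmain x hx hmem t le_rfl]
  exact Set.subset_biUnion_of_mem (u := fun i => associatedPrimes R (LocalCohomologyModule 𝔞 i M))
    (le_refl t : t ≤ t)
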